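/- Let $(X,\mathscr B,\mu)$ be a probability space and let $T:X\to X$ be an invertible, bi-measurable, $\mu$-preserving map such that no power of $T$ acts trivially modulo null sets: for every integer $p\ge 1$ there is $A\in\mathscr B$ with $\mu(T^{-p}A\,\triangle\,A)>0$. (On a standard probability space this says that for no $p\ge1$ one has $T^px=x$ for almost every $x$; in particular it holds for every aperiodic system.) Let $\omega:\mathbb N\to\mathbb R$ be a non-increasing sequence with $\omega(n)\to 0$, and let $\lambda>0$. Then there exist real numbers $\alpha<\beta$, a measurable function $f:X\to[0,1]$ and a sequence $(F_n)$ of non-empty finite subsets of $\mathbb Z$ such that 1. $(F_n)$ is a Følner sequence: $\lim_{n\to\infty}\frac{|(g+F_n)\,\triangle\,F_n|}{|F_n|}=0$ for every $g\in\mathbb Z$; 2. $(F_n)$ is $(1+\lambda)$-tempered: $\bigl|\bigcup_{i<n}(-F_i+F_n)\bigr|\le(1+\lambda)|F_n|$ for every $n$; 3. $\mu(D_N)>\omega(N)$ for all but finitely many $N$. Here $D_N$ is the set of all $x\in X$ for which the sequence of averages $a_n=\frac1{|F_n|}\sum_{g\in F_n}f(T^gx)$ fluctuates at least $N$ times across $(\alpha,\beta)$,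 i.e. there are indices $n_1<n_2<\dots<n_{2N}$ with $a_{n_i}\le\alpha$ for odd $i$ and $a_{n_i}\ge\beta$ for even $i$. -/

import Mathlib

open MeasureTheory Filter Topology
open scoped Pointwise symmDiff

noncomputable section

/-- A (left) Følner sequence in `ℤ`: nonempty finite sets `F n` with
`|(g + F n) ∆ F n| / |F n| → 0` for every `g`. -/
structure IsFolnerSeq (F : ℕ → Finset ℤ) : Prop where
  nonempty : ∀ n, (F n).Nonempty
  tendsto : ∀ g : ℤ,
    Tendsto (fun n => (((g +ᵥ F n) ∆ F n).card : ℝ) / ((F n).card : ℝ)) atTop (𝓝 0)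

/-- A (left) `c`-tempered sequence in `ℤ`: `|⋃_{i < n} (-F i + F n)| ≤ c |F n|` for all `n`. -/
def IsTempered (c : ℝ) (F : ℕ → Finset ℤ) : Prop :=
  ∀ n, (((Finset.range n).biUnion fun i => -F i + F n).card : ℝ) ≤ c * ((F n).card : ℝ)

/-- The real sequence `a` fluctuates (at least) `N` times across the gap `(α, β)`: there are
`n 0 < n 1 < ... < n (2N - 1)` such that `a` is `≤ α` at the first, third, ... of these indices
and `≥ β` at the second, fourth, ... of them. -/
def Fluctuates (a : ℕ → ℝ) (α β : ℝ) (N : ℕ) : Prop :=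
  ∃ n : Fin (2 * N) → ℕ, StrictMono n ∧
    ∀ i : Fin (2 * N), (Even (i : ℕ) → a (n i) ≤ α) ∧ (Odd (i : ℕ) → β ≤ a (n i))

variable {X : Type*} [AddAction ℤ X]

/-- The average `|S|⁻¹ ∑_{g ∈ S} f (T^g x)`, the `ℤ`-action being `g +ᵥ x = T^g x`. -/
def ergodicAverage (S : Finset ℤ) (f : X → ℝ) (x : X) : ℝ :=
  (∑ g ∈ S, f (g +ᵥ x)) / (S.card : ℝ)

/-- The set of points at which the averages of `f` along `F` fluctuate at least `N` times
across `(α, β)`. -/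
def fluctuationSet (F : ℕ → Finset ℤ) (f : X → ℝ) (α β : ℝ) (N : ℕ) : Set X :=
  {x | Fluctuates (fun n => ergodicAverage (F n) f x) α β N}

/-- No power `T^p`, `p ≥ 1`, acts trivially modulo `μ`-null sets. -/
def NoTrivialPower (X : Type*) [AddAction ℤ X] [MeasurableSpace X] (μ : Measure X) : Prop :=
  ∀ p : ℕ, 1 ≤ p → ∃ A : Set X, MeasurableSet A ∧ 0 < μ (((fun x : X => (p : ℤ) +ᵥ x) ⁻¹' A) ∆ A)

end

/-! ### Exhaustion in a finite measure space -/

section Exhaustion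

/-! Suppose a set `Ω` is met by the orbit of `x`, up to a long time, exactly at the times `g` with
`g % p < Q * L`, where `p` is about `2 * Q * L`. Averaging over whole periods gives about `1/2`.
Deleting from every period an interval of length `L` inside the pattern pushes the average down to
`(Q - 1) / (2 * Q - 1)`; deleting one just after the pattern keeps it at least `1/2`. Alternating
the two deletions makes the averages fluctuate. With `Q ^ n` periods in `F n`, the sets are
tempered: earlier sets are shorter by a factor of at least `Q`, and only a fraction of about `1 / (2
* Q)` is deleted. They are Følner because the periods tend to infinity.

Such patterns exist on a set of measure `ε` that does not depend on the length of the time window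
(`exists_hasPeriodicWindows`). This is decisive: once the `ε k` are fixed, `ω` dictates how many
fluctuations stage `k` must produce, and only then are the windows made long enough. Either Rokhlin
towers of every height fill a fixed proportion of the space, or small invariant sets contain
periodic pieces of arbitrarily large period. Finally `exists_set_of_hasPeriodicWindows` merges all
stages into one `Ω`, later stages overriding earlier ones on sets of summable measure. -/

theorem exists_maximal_measure_of_iUnion {X : Type*} [MeasurableSpace X] (μ : Measure X)
    [IsFiniteMeasure μ] (P : Set X → Prop) (h0 : P ∅)
    (hU : ∀ s : ℕ → Set X, Monotone s → (∀ n, P (s n)) → P (⋃ n, s n)) :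
    ∃ Q, P Q ∧ ∀ A, P A → Q ⊆ A → μ.real A ≤ μ.real Q := by
  have step : ∀ (n : ℕ) (A : {A // P A}), ∃ B : {A // P A}, A.1 ⊆ B.1 ∧
      ∀ C, P C → A.1 ⊆ C → μ.real C ≤ μ.real B.1 + 1 / ((n : ℝ) + 1) := by
    intro n A
    let s : Set ℝ := {r | ∃ B, P B ∧ A.1 ⊆ B ∧ μ.real B = r}
    have hne : s.Nonempty := ⟨_, A.1, A.2, subset_rfl, rfl⟩
    have hbd : BddAbove s := ⟨μ.real Set.univ, by
      rintro r ⟨B, -, -, rfl⟩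
      exact measureReal_mono (Set.subset_univ _)⟩
    have hpos : (0 : ℝ) < 1 / ((n : ℝ) + 1) := by positivity
    obtain ⟨r, ⟨B, hB, hAB, rfl⟩, hr⟩ :=
      exists_lt_of_lt_csSup hne (sub_lt_self (sSup s) hpos)
    refine ⟨⟨B, hB⟩, hAB, fun C hC hAC => ?_⟩
    have : μ.real C ≤ sSup s := le_csSup hbd ⟨C, hC, hAC, rfl⟩
    simp only
    linarith
  choose next hsub hnext using step
  -- Greedy choice: step `n` comes within `1 / (n + 1)` of the supremum over all admissible
  -- supersets, so no admissible superset of the union can gain measure.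
  let s : ℕ → {A // P A} := fun n => Nat.rec ⟨∅, h0⟩ next n
  have hs : ∀ n, s (n + 1) = next n (s n) := fun _ => rfl
  have hmono : Monotone fun n => (s n).1 := monotone_nat_of_le_succ fun n => by
    rw [hs]; exact hsub n (s n)
  refine ⟨⋃ n, (s n).1, hU _ hmono fun n => (s n).2, fun A hA hQA => ?_⟩
  refine le_of_forall_pos_le_add fun ε hε => ?_
  obtain ⟨n, hn⟩ := exists_nat_one_div_lt hε
  have h1 := hnext n (s n) A hA ((Set.subset_iUnion (fun n => (s n).1) n).trans hQA)
  have h2 : μ.real (s (n + 1)).1 ≤ μ.real (⋃ n, (s n).1) :=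
    measureReal_mono (Set.subset_iUnion (fun n => (s n).1) (n + 1))
  rw [hs] at h2
  linarith

end Exhaustion

/-! ### Sets on which a power acts trivially, and Rokhlin towers -/

section Shift

/-- The preimage `T⁻ᵍ A` of a set under the action of `g`. -/
def shiftPreimage {X : Type*} [AddAction ℤ X] (g : ℤ) (A : Set X) : Set X :=
  (fun x => g +ᵥ x) ⁻¹' A

@[simp]
theorem mem_shiftPreimage {X : Type*} [AddAction ℤ X] {g : ℤ} {A : Set X} {x : X} :
    x ∈ shiftPreimage g A ↔ g +ᵥ x ∈ A :=
  Iff.rfl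

/-- `T^j` acts trivially, modulo null sets, on the measurable subsets of `A`. -/
def TrivialOn {X : Type*} [AddAction ℤ X] [MeasurableSpace X] (μ : Measure X) (j : ℕ)
    (A : Set X) : Prop :=
  ∀ C ⊆ A, MeasurableSet C → μ (C \ shiftPreimage (j : ℤ) C) = 0

/-- The sets `T^j B`, `0 ≤ j < H`, are pairwise disjoint. -/
def IsTowerBase {X : Type*} [AddAction ℤ X] (H : ℕ) (B : Set X) : Prop :=
  ∀ x ∈ B, ∀ j : ℕ, 0 < j → j < H → (j : ℤ) +ᵥ x ∉ B

theorem TrivialOn.mono {X : Type*} [AddAction ℤ X] [MeasurableSpace X] {μ : Measure X} {j : ℕ}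
    {A B : Set X} (h : TrivialOn μ j B) (hAB : A ⊆ B) : TrivialOn μ j A :=
  fun C hC => h C (hC.trans hAB)

theorem IsTowerBase.eq_of_mem {X : Type*} [AddAction ℤ X] {H : ℕ} {B : Set X}
    (hB : IsTowerBase H B) {x : X} {a b : ℤ} (ha : a +ᵥ x ∈ B) (hb : b +ᵥ x ∈ B)
    (hab : a - b < H) (hba : b - a < H) : a = b := by
  have key : ∀ a b : ℤ, a +ᵥ x ∈ B → b +ᵥ x ∈ B → b - a < H → ¬ a < b := by
    intro a b ha hb hba hlt
    refine hB _ ha (b - a).toNat (by omega) (by omega) ?_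
    rw [Int.toNat_of_nonneg (by omega), vadd_vadd]
    simpa using hb
  have h1 := key a b ha hb hba
  have h2 := key b a hb ha hab
  omega

theorem measurableSet_shiftPreimage {X : Type*} [AddAction ℤ X] [MeasurableSpace X]
    [MeasurableConstVAdd ℤ X] {A : Set X} (hA : MeasurableSet A) (g : ℤ) :
    MeasurableSet (shiftPreimage g A) :=
  measurable_const_vadd g hA

@[simp]
theorem measure_shiftPreimage {X : Type*} [AddAction ℤ X] [MeasurableSpace X] {μ : Measure X}
    [VAddInvariantMeasure ℤ X μ] (g : ℤ) (A : Set X) : μ (shiftPreimage g A) = μ A :=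
  measure_preimage_vadd μ g A

@[simp]
theorem measureReal_shiftPreimage {X : Type*} [AddAction ℤ X] [MeasurableSpace X] {μ : Measure X}
    [VAddInvariantMeasure ℤ X μ] (g : ℤ) (A : Set X) :
    μ.real (shiftPreimage g A) = μ.real A := by
  simp [Measure.real]

theorem trivialOn_iUnion {X : Type*} [AddAction ℤ X] [MeasurableSpace X] {μ : Measure X}
    {j : ℕ} {s : ℕ → Set X} (hs : ∀ n, MeasurableSet (s n))
    (h : ∀ n, TrivialOn μ j (s n)) : TrivialOn μ j (⋃ n, s n) := by
  intro C hC hCm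
  refine measure_mono_null (t := ⋃ n, (C ∩ s n) \ shiftPreimage (j : ℤ) (C ∩ s n)) ?_
    (measure_iUnion_null fun n => h n _ Set.inter_subset_right (hCm.inter (hs n)))
  rintro x ⟨hx, hxj⟩
  obtain ⟨n, hn⟩ := Set.mem_iUnion.1 (hC hx)
  exact Set.mem_iUnion.2 ⟨n, ⟨hx, hn⟩, fun h => hxj h.1⟩

/-- Raise the height one step at a time: if `T^H` is not trivial on the current base, some `C`
inside it has points leaving `C` under `T^H`, and these form the next base. -/
theorem exists_isTowerBase_subset {X : Type*} [AddAction ℤ X] [MeasurableSpace X] {μ : Measure X}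
    [MeasurableConstVAdd ℤ X] [IsFiniteMeasure μ] {Z : Set X} (hZm : MeasurableSet Z)
    (hZ : 0 < μ Z) (H : ℕ)
    (h : ∀ j : ℕ, 0 < j → j < H → ∀ A ⊆ Z, MeasurableSet A → TrivialOn μ j A → μ A = 0) :
    ∃ D ⊆ Z, MeasurableSet D ∧ 0 < μ D ∧ IsTowerBase H D := by
  induction H with
  | zero => exact ⟨Z, subset_rfl, hZm, hZ, fun _ _ j _ hj => absurd hj (by omega)⟩
  | succ H ih =>
    obtain ⟨D, hDZ, hDm, hD, hDH⟩ := ih fun j hj hjH => h j hj (by omega)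
    rcases Nat.eq_zero_or_pos H with rfl | hH
    · exact ⟨D, hDZ, hDm, hD, fun _ _ j _ hj => by omega⟩
    have hnt : ¬ TrivialOn μ H D := fun ht => hD.ne' (h H hH (by omega) D hDZ hDm ht)
    simp only [TrivialOn, not_forall] at hnt
    obtain ⟨C, hCD, hCm, hC⟩ := hnt
    refine ⟨C \ shiftPreimage (H : ℤ) C, Set.sdiff_subset.trans (hCD.trans hDZ),
      hCm.diff (measurableSet_shiftPreimage hCm _), pos_iff_ne_zero.2 hC, ?_⟩
    rintro x ⟨hx, hxH⟩ j hj hjH hcon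
    rcases Nat.lt_succ_iff_lt_or_eq.1 hjH with hlt | rfl
    · exact hDH x (hCD hx) j hj hlt (hCD hcon.1)
    · exact hxH hcon.1

/-- A point of `C` that is outside `C` after `m` steps of `T^j` must leave `C` at some single step,
hence lies in a shift of a null set. -/
theorem TrivialOn.of_dvd {X : Type*} [AddAction ℤ X] [MeasurableSpace X] {μ : Measure X}
    [VAddInvariantMeasure ℤ X μ] {j N : ℕ} {A : Set X} (h : TrivialOn μ j A) (hjN : j ∣ N) :
    TrivialOn μ N A := by
  obtain ⟨m, rfl⟩ := hjN
  intro C hCA hC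
  refine measure_mono_null (t := ⋃ i : ℕ, shiftPreimage ((i * j : ℕ) : ℤ)
    (C \ shiftPreimage (j : ℤ) C)) ?_ (measure_iUnion_null fun i => ?_)
  · rintro x ⟨hx, hxm⟩
    by_contra hcon
    simp only [Set.mem_iUnion, mem_shiftPreimage, Set.mem_sdiff, not_exists, not_and,
      not_not] at hcon
    refine hxm ?_
    have : ∀ i : ℕ, ((i * j : ℕ) : ℤ) +ᵥ x ∈ C := by
      intro i
      induction i with
      | zero => simpa using hx
      | succ i ih =>
        have := hcon i ih
        rw [vadd_vadd] at this
        convert this using 2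
        push_cast
        ring
    rw [mem_shiftPreimage, mul_comm]
    exact this m
  · rw [measure_shiftPreimage]
    exact h C hCA hC

theorem exists_maximal_trivialOn {X : Type*} [AddAction ℤ X] [MeasurableSpace X] {μ : Measure X}
    [IsFiniteMeasure μ] (N : ℕ) :
    ∃ Q, MeasurableSet Q ∧ TrivialOn μ N Q ∧
      ∀ A, MeasurableSet A → TrivialOn μ N A → μ (A \ Q) = 0 := by
  obtain ⟨Q, ⟨hQm, hQ⟩, hmax⟩ := exists_maximal_measure_of_iUnion μ
    (fun A => MeasurableSet A ∧ TrivialOn μ N A)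
    ⟨MeasurableSet.empty, fun C hC _ => by simp [Set.subset_empty_iff.1 hC]⟩
    (fun s _ hs => ⟨MeasurableSet.iUnion fun n => (hs n).1,
      trivialOn_iUnion (fun n => (hs n).1) fun n => (hs n).2⟩)
  refine ⟨Q, hQm, hQ, fun A hAm hA => ?_⟩
  have hU : TrivialOn μ N (Q ∪ A) := by
    have := trivialOn_iUnion (μ := μ) (j := N) (s := fun n : ℕ => if n = 0 then Q else A)
      (fun n => by split_ifs <;> assumption)
      (fun n => by split_ifs <;> assumption)
    refine this.mono (Set.union_subset ?_ ?_)
    · exact Set.subset_iUnion_of_subset 0 (by simp)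
    · exact Set.subset_iUnion_of_subset 1 (by simp)
  have h1 := hmax _ ⟨hQm.union hAm, hU⟩ Set.subset_union_left
  rw [← Set.union_sdiff_self, measureReal_union Set.disjoint_sdiff_right (hAm.diff hQm)] at h1
  have h2 : μ.real (A \ Q) = 0 := le_antisymm (by linarith) measureReal_nonneg
  exact (measureReal_eq_zero_iff).1 h2

variable {X : Type*} [AddAction ℤ X] [MeasurableSpace X] [MeasurableConstVAdd ℤ X]
  {μ : Measure X} [VAddInvariantMeasure ℤ X μ]

theorem TrivialOn.shiftPreimage {j : ℕ} {A : Set X} (h : TrivialOn μ j A) (g : ℤ) :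
    TrivialOn μ j (shiftPreimage g A) := by
  intro C hC hCm
  have h1 := h (_root_.shiftPreimage (-g) C)
    (fun x hx => by simpa [vadd_vadd] using hC hx) (measurableSet_shiftPreimage hCm _)
  rw [← measure_shiftPreimage (μ := μ) (-g)]
  convert h1 using 2
  ext x
  simp [vadd_vadd, add_comm]

theorem measure_diff_shiftPreimage_comm [IsFiniteMeasure μ] {A : Set X} (hA : MeasurableSet A)
    (g : ℤ) : μ (A \ shiftPreimage g A) = μ (shiftPreimage g A \ A) := by
  have hA' := measurableSet_shiftPreimage hA g
  have h1 := measure_inter_add_sdiff (μ := μ) A hA'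
  have h2 := measure_inter_add_sdiff (μ := μ) (shiftPreimage g A) hA
  rw [measure_shiftPreimage, Set.inter_comm, ← h1] at h2
  exact ((ENNReal.add_right_inj (measure_ne_top μ _)).1 h2).symm

/-- The complement of the maximal set on which `T^N` acts trivially. -/
theorem exists_nowhere_trivialOn [IsFiniteMeasure μ] (hX : NoTrivialPower X μ) {N : ℕ}
    (hN : 1 ≤ N) :
    ∃ Y, MeasurableSet Y ∧ 0 < μ Y ∧ TrivialOn μ N Yᶜ ∧
      (∀ A ⊆ Y, MeasurableSet A → TrivialOn μ N A → μ A = 0) ∧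
      ∀ g, μ (shiftPreimage g Y \ Y) = 0 := by
  obtain ⟨Q, hQm, hQ, hmax⟩ := exists_maximal_trivialOn (μ := μ) N
  refine ⟨Qᶜ, hQm.compl, ?_, by rwa [compl_compl], ?_, fun g => ?_⟩
  · rw [pos_iff_ne_zero]
    intro h0
    obtain ⟨A, hAm, hA⟩ := hX N hN
    have h1 : μ (A \ shiftPreimage (N : ℤ) A) = 0 := by
      refine measure_mono_null (t := Qᶜ ∪ ((A ∩ Q) \ shiftPreimage (N : ℤ) (A ∩ Q))) ?_
        (measure_union_null h0 (hQ _ Set.inter_subset_right (hAm.inter hQm)))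
      rintro x ⟨hx, hxN⟩
      by_cases hxQ : x ∈ Q
      · exact Or.inr ⟨⟨hx, hxQ⟩, fun h => hxN h.1⟩
      · exact Or.inl hxQ
    have h2 := h1
    rw [measure_diff_shiftPreimage_comm hAm] at h2
    exact hA.ne' (measure_union_null h2 h1)
  · intro A hAY hAm hA
    have := hmax A hAm hA
    rwa [sdiff_eq_left.2 (Set.subset_compl_iff_disjoint_right.1 hAY)] at this
  -- Shifts of `Q` are again sets of trivial action, so maximality makes `Q` invariant modulo null
  -- sets.
  · have h1 := hmax _ (measurableSet_shiftPreimage hQm (-g)) (hQ.shiftPreimage (-g))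
    rw [← measure_shiftPreimage (μ := μ) g] at h1
    convert h1 using 2
    ext x
    simp [vadd_vadd, and_comm]

/-- A form of the Rokhlin lemma. -/
theorem exists_isTowerBase_measure_ge [IsFiniteMeasure μ] {Y : Set X} (hYm : MeasurableSet Y)
    {H : ℕ} (hH : 0 < H)
    (h : ∀ j : ℕ, 0 < j → j < H → ∀ A ⊆ Y, MeasurableSet A → TrivialOn μ j A → μ A = 0) :
    ∃ B, MeasurableSet B ∧ IsTowerBase H B ∧ μ.real Y ≤ 2 * H * μ.real B := by
  obtain ⟨B, ⟨hBm, hBY, hB⟩, hmax⟩ := exists_maximal_measure_of_iUnion μ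
    (fun A => MeasurableSet A ∧ A ⊆ Y ∧ IsTowerBase H A)
    ⟨MeasurableSet.empty, Set.empty_subset _, fun x hx => hx.elim⟩
    (fun s hmono hs => ⟨MeasurableSet.iUnion fun n => (hs n).1,
      Set.iUnion_subset fun n => (hs n).2.1, by
        intro x hx j hj hjH hcon
        obtain ⟨m, hm⟩ := Set.mem_iUnion.1 hx
        obtain ⟨n, hn⟩ := Set.mem_iUnion.1 hcon
        exact (hs (max m n)).2.2 x (hmono (le_max_left m n) hm) j hj hjH
          (hmono (le_max_right m n) hn)⟩)
  refine ⟨B, hBm, hB, ?_⟩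
  set U : Set X := ⋃ i ∈ Finset.Ioo (-(H : ℤ)) H, shiftPreimage i B with hU
  have hUm : MeasurableSet U :=
    Finset.measurableSet_biUnion _ fun i _ => measurableSet_shiftPreimage hBm i
  have hUB : ∀ {x : X} (i : ℤ), -(H : ℤ) < i → i < H → i +ᵥ x ∈ B → x ∈ U := by
    intro x i h1 h2 hx
    exact Set.mem_biUnion (Finset.mem_coe.2 (Finset.mem_Ioo.2 ⟨h1, h2⟩)) hx
  -- A base found outside `U` is more than `H - 1` steps away from `B` in both directions, so adding
  -- it to `B` would contradict maximality.
  have hnull : μ (Y \ U) = 0 := by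
    by_contra hne
    obtain ⟨D, hDZ, hDm, hD, hDH⟩ := exists_isTowerBase_subset (hYm.diff hUm)
      (pos_iff_ne_zero.2 hne) H fun j hj hjH A hA =>
        h j hj hjH A (hA.trans Set.sdiff_subset)
    have hdisj : Disjoint B D := Set.disjoint_left.2 fun x hxB hxD =>
      (hDZ hxD).2 (hUB 0 (by omega) (by omega) (by simpa using hxB))
    have h1 := hmax (B ∪ D) ⟨hBm.union hDm,
      Set.union_subset hBY (hDZ.trans Set.sdiff_subset), ?_⟩ Set.subset_union_left
    · rw [measureReal_union hdisj hDm] at h1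
      have : μ.real D = 0 := le_antisymm (by linarith) measureReal_nonneg
      exact hD.ne' ((measureReal_eq_zero_iff).1 this)
    · rintro x (hx | hx) j hj hjH (hcon | hcon)
      · exact hB x hx j hj hjH hcon
      · refine (hDZ hcon).2 (hUB (-(j : ℤ)) (by omega) (by omega) ?_)
        simpa [vadd_vadd] using hx
      · exact (hDZ hx).2 (hUB (j : ℤ) (by omega) (by omega) hcon)
      · exact hDH x hx j hj hjH hcon
  have h1 : μ.real Y ≤ μ.real U := by
    have : μ.real Y ≤ μ.real (U ∪ Y \ U) := measureReal_mono (by simp)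
    refine this.trans ((measureReal_union_le _ _).trans ?_)
    simp [Measure.real, hnull]
  have h2 : μ.real U ≤ ∑ i ∈ Finset.Ioo (-(H : ℤ)) H, μ.real (shiftPreimage i B) :=
    measureReal_biUnion_finset_le _ _
  refine h1.trans (h2.trans ?_)
  simp only [measureReal_shiftPreimage, Finset.sum_const, Int.card_Ioo, nsmul_eq_mul]
  have h3 : ((((H : ℤ) - -(H : ℤ) - 1).toNat : ℕ) : ℝ) ≤ 2 * H := by
    have : ((H : ℤ) - -(H : ℤ) - 1).toNat ≤ 2 * H := by omega
    exact_mod_cast this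
  exact mul_le_mul_of_nonneg_right h3 measureReal_nonneg

end Shift

/-! ### Long periodic windows of measure independent of their length -/

section Windows

/-- For every length `W` there is a region `S` such that on a set of measure at least `ε` the
orbit stays in `S` up to time `W`, and passes through a part `Z` of `S` exactly at the times
`g` with `g % p < h`; the points that reach `S` before time `W` have measure at most `δ`. -/
def HasPeriodicWindows {X : Type*} [AddAction ℤ X] [MeasurableSpace X] (μ : Measure X) (p : ℕ)
    (ε δ : ℝ) : Prop :=
  ∀ W h : ℕ, h ≤ p → ∃ S Z E : Set X, MeasurableSet S ∧ MeasurableSet Z ∧ Z ⊆ S ∧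
    (∀ x ∈ E, ∀ g : ℕ, g < W → (g : ℤ) +ᵥ x ∈ S ∧ ((g : ℤ) +ᵥ x ∈ Z ↔ g % p < h)) ∧
    ε ≤ μ.real E ∧ μ.real (⋃ g ∈ Finset.range W, shiftPreimage (g : ℤ) S) ≤ δ

/-- The union of the levels `T^i B`, `i ∈ I`, of a tower with base `B`. -/
def towerLevels {X : Type*} [AddAction ℤ X] (B : Set X) (I : Finset ℕ) : Set X :=
  ⋃ i ∈ I, shiftPreimage (-(i : ℤ)) B

theorem mem_towerLevels {X : Type*} [AddAction ℤ X] {B : Set X} {I : Finset ℕ} {x : X} :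
    x ∈ towerLevels B I ↔ ∃ i ∈ I, (-(i : ℤ)) +ᵥ x ∈ B := by
  simp [towerLevels]

theorem towerLevels_mono {X : Type*} [AddAction ℤ X] {B : Set X} {I J : Finset ℕ} (h : I ⊆ J) :
    towerLevels B I ⊆ towerLevels B J :=
  Set.biUnion_subset_biUnion_left h

variable {X : Type*} [AddAction ℤ X] [MeasurableSpace X] [MeasurableConstVAdd ℤ X]

theorem measurableSet_towerLevels {B : Set X} (hB : MeasurableSet B) (I : Finset ℕ) :
    MeasurableSet (towerLevels B I) :=
  Finset.measurableSet_biUnion _ fun _ _ => measurableSet_shiftPreimage hB _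

variable {μ : Measure X} [VAddInvariantMeasure ℤ X μ]

theorem measureReal_towerLevels [IsFiniteMeasure μ] {H : ℕ} {B : Set X} (hBm : MeasurableSet B)
    (hB : IsTowerBase H B) {I : Finset ℕ} (hI : I ⊆ Finset.range H) :
    μ.real (towerLevels B I) = I.card * μ.real B := by
  rw [towerLevels, measureReal_biUnion_finset]
  · simp
  · intro i hi j hj hij
    refine Set.disjoint_left.2 fun x hx hx' => hij ?_
    have h1 := Finset.mem_range.1 (hI hi)
    have h2 := Finset.mem_range.1 (hI hj)
    have := hB.eq_of_mem hx hx' (by omega) (by omega)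
    omega
  · exact fun _ _ => measurableSet_shiftPreimage hBm _

/-- In a tower of height `2 * w * A`, the lowest `2 * w` levels serve as the region. Good points
start on levels below `w` divisible by `p`; they fill a proportion of the tower depending only on
`p` and `A`, which is why `ε` is independent of `W`. -/
theorem exists_hasPeriodicWindows_of_towers [IsProbabilityMeasure μ] {c : ℝ} (hc : 0 < c)
    (h : ∀ H : ℕ, 0 < H → ∃ B, MeasurableSet B ∧ IsTowerBase H B ∧ c ≤ 2 * H * μ.real B)
    {p : ℕ} (hp : 0 < p) {δ : ℝ} (hδ : 0 < δ) :
    ∃ ε, 0 < ε ∧ HasPeriodicWindows μ p ε δ := by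
  obtain ⟨A, hA⟩ := exists_nat_gt (2 / δ)
  have hA0 : (0 : ℝ) < A := (by positivity : (0 : ℝ) < 2 / δ).trans hA
  have hA1 : 0 < A := by exact_mod_cast hA0
  have hp0 : (0 : ℝ) < p := by exact_mod_cast hp
  refine ⟨c / (4 * p * A), by positivity, fun W r hr => ?_⟩
  -- This gives `W < w`, so an orbit starting below level `w` stays below level `2 * w` up to time
  -- `W`.
  obtain ⟨n, hn⟩ : ∃ n, n = W + 1 := ⟨_, rfl⟩
  obtain ⟨w, hw⟩ : ∃ w, w = p * n := ⟨_, rfl⟩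
  have hWw : W < w := by rw [hw]; nlinarith
  obtain ⟨H, hH⟩ : ∃ H, H = 2 * w * A := ⟨_, rfl⟩
  have hwH : 2 * w ≤ H := by rw [hH]; nlinarith
  obtain ⟨B, hBm, hB, hcB⟩ := h H (by omega)
  have hB0 : 0 ≤ μ.real B := measureReal_nonneg
  have hHB : H * μ.real B ≤ 1 := by
    rw [← Finset.card_range H, ← measureReal_towerLevels hBm hB subset_rfl]
    exact measureReal_le_one
  have hHr : (H : ℝ) = 2 * w * A := by rw [hH]; push_cast; ring
  have hwr : (w : ℝ) = p * n := by rw [hw]; push_cast; ring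
  refine ⟨towerLevels B (Finset.range (2 * w)),
    towerLevels B ((Finset.range (2 * w)).filter fun i => i % p < r),
    towerLevels B ((Finset.range n).image fun m => p * m),
    measurableSet_towerLevels hBm _, measurableSet_towerLevels hBm _,
    towerLevels_mono (Finset.filter_subset _ _), ?_, ?_, ?_⟩
  · intro x hx g hg
    obtain ⟨i, hi, hx⟩ := mem_towerLevels.1 hx
    obtain ⟨m, hm, rfl⟩ := Finset.mem_image.1 hi
    have hmn : p * m < w := by
      rw [hw]; exact Nat.mul_lt_mul_of_pos_left (Finset.mem_range.1 hm) hp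
    have hlev : (-((p * m + g : ℕ) : ℤ)) +ᵥ ((g : ℤ) +ᵥ x) ∈ B := by
      rw [vadd_vadd]
      convert hx using 2
      push_cast
      ring
    refine ⟨mem_towerLevels.2 ⟨p * m + g, Finset.mem_range.2 (by omega), hlev⟩, ?_, ?_⟩
    · intro hz
      obtain ⟨i, hi, hxi⟩ := mem_towerLevels.1 hz
      obtain ⟨hi, hir⟩ := Finset.mem_filter.1 hi
      have hi := Finset.mem_range.1 hi
      have := hB.eq_of_mem hxi hlev (by omega) (by omega)
      have : i = p * m + g := by omega
      rwa [this, Nat.mul_add_mod] at hir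
    · intro hgr
      exact mem_towerLevels.2 ⟨p * m + g, Finset.mem_filter.2
        ⟨Finset.mem_range.2 (by omega), by rwa [Nat.mul_add_mod]⟩, hlev⟩
  · rw [measureReal_towerLevels hBm hB, Finset.card_image_of_injective _
      (fun a b hab => Nat.eq_of_mul_eq_mul_left hp hab), Finset.card_range,
      div_le_iff₀ (by positivity)]
    · rw [hHr, hwr] at hcB
      linarith
    · intro i hi
      obtain ⟨m, hm, rfl⟩ := Finset.mem_image.1 hi
      have : p * m < w := by
        rw [hw]; exact Nat.mul_lt_mul_of_pos_left (Finset.mem_range.1 hm) hp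
      exact Finset.mem_range.2 (by omega)
  · have hsub : (⋃ g ∈ Finset.range W, shiftPreimage (g : ℤ)
        (towerLevels B (Finset.range (2 * w)))) ⊆
        ⋃ i ∈ Finset.Ico (-(2 * w : ℤ)) W, shiftPreimage i B := by
      intro x hx
      simp only [Set.mem_iUnion, mem_shiftPreimage, mem_towerLevels, vadd_vadd] at hx ⊢
      obtain ⟨g, hg, i, hi, hx⟩ := hx
      rw [Finset.mem_range] at hg hi
      exact ⟨-(i : ℤ) + g, Finset.mem_Ico.2 (by omega), hx⟩
    refine (measureReal_mono hsub (measure_ne_top _ _)).trans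
      ((measureReal_biUnion_finset_le _ _).trans ?_)
    simp only [measureReal_shiftPreimage, Finset.sum_const, Int.card_Ico, nsmul_eq_mul]
    have h1 : ((((W : ℤ) - -(2 * w : ℤ)).toNat : ℕ) : ℝ) ≤ 4 * w := by
      have : ((W : ℤ) - -(2 * w : ℤ)).toNat ≤ 4 * w := by omega
      exact_mod_cast this
    refine (mul_le_mul_of_nonneg_right h1 hB0).trans ?_
    rw [hHr] at hHB
    rw [div_lt_iff₀ hδ] at hA
    have h2 : 4 * w * μ.real B * A ≤ δ * A := by linarith
    exact le_of_mul_le_mul_right h2 hA0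

/-- Let `p` be the least period occurring on a non-null part of `C`. Minimality provides a tower of
height `p` there, and triviality of `T^p` brings almost every base point back at all multiples of
`p`: the windows have unlimited length. A period below `P` would divide `P.factorial`, which
`hYtriv` forbids. -/
theorem exists_hasPeriodicWindows_of_trivialOn [IsFiniteMeasure μ] {Y C : Set X} {P N : ℕ}
    (hN : 0 < N)
    (hYtriv : ∀ A ⊆ Y, MeasurableSet A → TrivialOn μ P.factorial A → μ A = 0)
    (hYinv : ∀ g, μ (shiftPreimage g Y \ Y) = 0)
    (hCY : C ⊆ Y) (hCm : MeasurableSet C) (hC : 0 < μ C) (hCN : TrivialOn μ N C) :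
    ∃ p ≥ P, ∃ ε, 0 < ε ∧ HasPeriodicWindows μ p ε (μ.real Y) := by
  classical
  have hex : ∃ i : ℕ, 0 < i ∧ ∃ D ⊆ C, MeasurableSet D ∧ 0 < μ D ∧ TrivialOn μ i D :=
    ⟨N, hN, C, subset_rfl, hCm, hC, hCN⟩
  obtain ⟨p, ⟨hp0, D, hDC, hDm, hD, hDp⟩, hmin⟩ : ∃ p : ℕ,
      (0 < p ∧ ∃ D ⊆ C, MeasurableSet D ∧ 0 < μ D ∧ TrivialOn μ p D) ∧
      ∀ j < p, ¬ (0 < j ∧ ∃ D ⊆ C, MeasurableSet D ∧ 0 < μ D ∧ TrivialOn μ j D) :=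
    ⟨Nat.find hex, Nat.find_spec hex, fun j hj => Nat.find_min hex hj⟩
  have hPp : P ≤ p := by
    by_contra hlt
    exact hD.ne' (hYtriv D (hDC.trans hCY) hDm
      (hDp.of_dvd (Nat.dvd_factorial hp0 (by omega))))
  obtain ⟨B, hBD, hBm, hB, hBp⟩ := exists_isTowerBase_subset hDm hD p fun j hj hjp A hA hAm hAj =>
    by_contra fun hne => hmin j hjp ⟨hj, A, hA.trans hDC, hAm, pos_iff_ne_zero.2 hne, hAj⟩
  let E : Set X := {x ∈ B | ∀ m : ℕ, ((m * p : ℕ) : ℤ) +ᵥ x ∈ B}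
  have hE : μ.real B ≤ μ.real E := by
    have hnull : μ (B \ E) = 0 := by
      refine measure_mono_null (t := ⋃ m : ℕ, B \ shiftPreimage ((m * p : ℕ) : ℤ) B) ?_
        (measure_iUnion_null fun m =>
          (hDp.mono hBD).of_dvd (Nat.dvd_mul_left p m) B subset_rfl hBm)
      rintro x ⟨hx, hxE⟩
      have : ¬ ∀ m : ℕ, ((m * p : ℕ) : ℤ) +ᵥ x ∈ B := fun h => hxE ⟨hx, h⟩
      push Not at this
      obtain ⟨m, hm⟩ := this
      exact Set.mem_iUnion.2 ⟨m, hx, hm⟩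
    have h1 : μ.real B ≤ μ.real (E ∪ B \ E) := measureReal_mono (by simp)
    refine h1.trans ((measureReal_union_le _ _).trans ?_)
    simp [Measure.real, hnull]
  refine ⟨p, hPp, μ.real B, ENNReal.toReal_pos hB.ne' (measure_ne_top _ _), fun W r hr =>
    ⟨towerLevels B (Finset.range p), towerLevels B (Finset.range r), E,
    measurableSet_towerLevels hBm _, measurableSet_towerLevels hBm _,
    towerLevels_mono (Finset.range_subset_range.2 hr), ?_, hE, ?_⟩⟩
  · intro x hx g hg
    have hlev : (-((g % p : ℕ) : ℤ)) +ᵥ ((g : ℤ) +ᵥ x) ∈ B := by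
      rw [vadd_vadd]
      convert hx.2 (g / p) using 2
      have := Nat.div_add_mod' g p
      omega
    have hgp := Nat.mod_lt g hp0
    refine ⟨mem_towerLevels.2 ⟨g % p, Finset.mem_range.2 hgp, hlev⟩, ?_, ?_⟩
    · intro hz
      obtain ⟨i, hi, hxi⟩ := mem_towerLevels.1 hz
      rw [Finset.mem_range] at hi
      have := hBp.eq_of_mem hxi hlev (by omega) (by omega)
      omega
    · intro hgr
      exact mem_towerLevels.2 ⟨g % p, Finset.mem_range.2 hgr, hlev⟩
  · have hsub : (⋃ g ∈ Finset.range W, shiftPreimage (g : ℤ) (towerLevels B (Finset.range p))) ⊆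
        Y ∪ ⋃ g : ℤ, shiftPreimage g Y \ Y := by
      intro x hx
      simp only [Set.mem_iUnion, mem_shiftPreimage, mem_towerLevels, vadd_vadd] at hx
      obtain ⟨g, -, i, -, hx⟩ := hx
      by_cases hxY : x ∈ Y
      · exact Or.inl hxY
      · exact Or.inr (Set.mem_iUnion.2 ⟨_, hCY (hDC (hBD hx)), hxY⟩)
    refine (measureReal_mono hsub).trans ((measureReal_union_le _ _).trans ?_)
    simp [Measure.real, measure_iUnion_null hYinv]

/-- `Y n` is the part where `T^(n!)` is nowhere trivial; factorials make it decrease modulo null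
sets. If its measure stays above some `c > 0`, towers of all heights exist. Otherwise a small `Y M`
loses mass at some later `n`, and the lost part has period `n!`. -/
theorem exists_hasPeriodicWindows [IsProbabilityMeasure μ] (hX : NoTrivialPower X μ)
    (P : ℕ) {δ : ℝ} (hδ : 0 < δ) :
    ∃ p ≥ P, ∃ ε, 0 < ε ∧ HasPeriodicWindows μ p ε δ := by
  choose Y hYm hY hYc hYtriv hYinv using fun P : ℕ =>
    exists_nowhere_trivialOn (μ := μ) hX (Nat.one_le_iff_ne_zero.2 P.factorial_ne_zero)
  by_cases hc : ∃ c : ℝ, 0 < c ∧ ∀ n, c ≤ μ.real (Y n)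
  · obtain ⟨c, hc, hcY⟩ := hc
    obtain ⟨ε, hε⟩ := exists_hasPeriodicWindows_of_towers (μ := μ) hc (fun H hH => by
      obtain ⟨B, hBm, hB, hYB⟩ := exists_isTowerBase_measure_ge (hYm H) hH
        fun j hj hjH A hA hAm hAj =>
          hYtriv H A hA hAm (hAj.of_dvd (Nat.dvd_factorial hj hjH.le))
      exact ⟨B, hBm, hB, (hcY H).trans hYB⟩) (Nat.succ_pos P) hδ
    exact ⟨P + 1, Nat.le_succ P, ε, hε⟩
  · push Not at hc
    have hmono : ∀ {m n : ℕ}, m ≤ n → μ (Y n \ Y m) = 0 := by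
      intro m n hmn
      refine hYtriv n _ Set.sdiff_subset ((hYm n).diff (hYm m)) ?_
      exact ((hYc m).of_dvd (Nat.factorial_dvd_factorial hmn)).mono fun x hx => hx.2
    obtain ⟨k, hk⟩ := hc δ hδ
    have hkP : μ.real (Y (max k (P + 1))) ≤ δ := by
      refine le_trans ?_ hk.le
      have h1 : μ.real (Y (max k (P + 1))) ≤ μ.real (Y k ∪ Y (max k (P + 1)) \ Y k) :=
        measureReal_mono (by simp)
      refine h1.trans ((measureReal_union_le _ _).trans ?_)
      simp [Measure.real, hmono (le_max_left k (P + 1))]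
    set M := max k (P + 1) with hM
    obtain ⟨n, hn⟩ := hc (μ.real (Y M)) (ENNReal.toReal_pos (hY M).ne' (measure_ne_top _ _))
    have hpos : 0 < μ (Y M \ Y n) := by
      rw [pos_iff_ne_zero]
      intro h0
      have h1 : μ.real (Y M) ≤ μ.real (Y n ∪ Y M \ Y n) := measureReal_mono (by simp)
      have h2 := measureReal_union_le (μ := μ) (Y n) (Y M \ Y n)
      have h3 : μ.real (Y M \ Y n) = 0 := by simp [Measure.real, h0]
      linarith
    obtain ⟨p, hp, ε, hε, hw⟩ := exists_hasPeriodicWindows_of_trivialOn (μ := μ) (P := M)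
      n.factorial_pos (hYtriv M) (hYinv M) Set.sdiff_subset
      ((hYm M).diff (hYm n)) hpos ((hYc n).mono fun x hx => hx.2)
    refine ⟨p, by omega, ε, hε, fun W r hr => ?_⟩
    obtain ⟨S, Z, E, h1, h2, h3, h4, h5, h6⟩ := hw W r hr
    exact ⟨S, Z, E, h1, h2, h3, h4, h5, h6.trans hkP⟩

end Windows

/-! ### Punctured blocks: the Følner and tempered conditions -/

section PuncturedBlocks

/-- `R` consecutive blocks of length `p`, from each of which the subinterval
`[s, s + L)` is removed. -/
def puncturedBlocks (p R s L : ℕ) : Finset ℤ :=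
  (Finset.range R ×ˢ (Finset.range p \ Finset.Ico s (s + L))).image
    fun a => (p : ℤ) * a.1 + a.2

theorem mem_puncturedBlocks {p R s L : ℕ} {x : ℤ} : x ∈ puncturedBlocks p R s L ↔
    ∃ m < R, ∃ y < p, ¬ (s ≤ y ∧ y < s + L) ∧ (p : ℤ) * m + y = x := by
  simp only [puncturedBlocks, Finset.mem_image, Finset.mem_product, Finset.mem_sdiff,
    Finset.mem_range, Finset.mem_Ico, Prod.exists]
  constructor
  · rintro ⟨m, y, ⟨hm, hy, hyn⟩, rfl⟩
    exact ⟨m, hm, y, hy, hyn, rfl⟩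
  · rintro ⟨m, hm, y, hy, hyn, rfl⟩
    exact ⟨m, y, ⟨hm, hy, hyn⟩, rfl⟩

theorem sum_puncturedBlocks {p R s L : ℕ} (φ : ℤ → ℝ) (ψ : ℕ → ℝ)
    (h : ∀ m y : ℕ, m < R → y < p → φ ((p : ℤ) * m + y) = ψ y) :
    ∑ g ∈ puncturedBlocks p R s L, φ g =
      R * ∑ y ∈ Finset.range p \ Finset.Ico s (s + L), ψ y := by
  rw [puncturedBlocks, Finset.sum_image, Finset.sum_product, Finset.sum_congr rfl (g := fun _ =>
    ∑ y ∈ Finset.range p \ Finset.Ico s (s + L), ψ y), Finset.sum_const, Finset.card_range,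
    nsmul_eq_mul]
  · intro m hm
    refine Finset.sum_congr rfl fun y hy => h m y (Finset.mem_range.1 hm) ?_
    exact Finset.mem_range.1 (Finset.mem_sdiff.1 hy).1
  · rintro ⟨m, y⟩ hmy ⟨m', y'⟩ hmy' heq
    simp only [Finset.coe_product, Set.mem_prod, Finset.mem_coe, Finset.mem_sdiff,
      Finset.mem_range] at hmy hmy' heq
    have hy := hmy.2.1
    have hy' := hmy'.2.1
    have heq' : p * m + y = p * m' + y' := by exact_mod_cast heq
    have h1 : y = y' := by
      have := congrArg (· % p) heq'
      simpa [Nat.mod_eq_of_lt hy, Nat.mod_eq_of_lt hy'] using this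
    subst h1
    have h2 : m = m' := Nat.eq_of_mul_eq_mul_left (by omega) (Nat.add_right_cancel heq')
    rw [h2]

theorem card_puncturedBlocks {p R s L : ℕ} (hs : s + L ≤ p) :
    (puncturedBlocks p R s L).card = R * (p - L) := by
  have h := sum_puncturedBlocks (p := p) (R := R) (s := s) (L := L) (fun _ => 1) (fun _ => 1)
    fun _ _ _ _ => rfl
  simp only [Finset.sum_const, nsmul_eq_mul, mul_one] at h
  rw [Finset.card_sdiff_of_subset, Finset.card_range, Nat.card_Ico, Nat.add_sub_cancel_left] at h
  · exact_mod_cast h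
  · intro y hy
    rw [Finset.mem_Ico] at hy
    rw [Finset.mem_range]
    omega

theorem nonneg_and_lt_of_mem_puncturedBlocks {p R s L : ℕ} {x : ℤ}
    (hx : x ∈ puncturedBlocks p R s L) : 0 ≤ x ∧ x < (p * R : ℕ) := by
  obtain ⟨m, hm, y, hy, -, rfl⟩ := mem_puncturedBlocks.1 hx
  refine ⟨by positivity, ?_⟩
  have : p * m + y < p * R := by
    calc p * m + y < p * (m + 1) := by rw [mul_add]; omega
      _ ≤ p * R := Nat.mul_le_mul_left _ hm
  exact_mod_cast this

/-- Consecutive blocks are adjacent, so a unit shift creates new points only at the start of each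
gap and at the far end. -/
theorem card_one_vadd_symmDiff_puncturedBlocks_le {p R s L : ℕ} :
    (((1 : ℤ) +ᵥ puncturedBlocks p R s L) ∆ puncturedBlocks p R s L).card ≤ 2 * R + 4 := by
  set F := puncturedBlocks p R s L with hF
  have hsub : ((1 : ℤ) +ᵥ F) \ F ⊆
      insert ((p : ℤ) * R) ((Finset.range (R + 1)).image fun m : ℕ => (p : ℤ) * m + s) := by
    intro x hx
    obtain ⟨hx1, hx2⟩ := Finset.mem_sdiff.1 hx
    obtain ⟨z, hz, rfl⟩ := Finset.mem_vadd_finset.1 hx1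
    obtain ⟨m, hm, y, hy, hyn, rfl⟩ := mem_puncturedBlocks.1 hz
    rw [hF, mem_puncturedBlocks] at hx2
    simp only [vadd_eq_add, Finset.mem_insert, Finset.mem_image, Finset.mem_range] at hx2 ⊢
    by_cases hyp : y + 1 < p
    · right
      refine ⟨m, by omega, ?_⟩
      have : y + 1 = s := by
        by_contra hne
        exact hx2 ⟨m, hm, y + 1, hyp, by omega, by push_cast; ring⟩
      rw [← this]
      push_cast
      ring
    · have hyp : p = y + 1 := by omega
      by_cases hmR : m + 1 = R
      · left
        rw [← hmR, hyp]
        push_cast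
        ring
      · right
        refine ⟨m + 1, by omega, ?_⟩
        have : s = 0 := by
          by_contra hne
          exact hx2 ⟨m + 1, by omega, 0, by omega, by omega, by rw [hyp]; push_cast; ring⟩
        rw [this, hyp]
        push_cast
        ring
  have h1 : (((1 : ℤ) +ᵥ F) \ F).card ≤ R + 2 := by
    refine (Finset.card_le_card hsub).trans ((Finset.card_insert_le _ _).trans ?_)
    have := Finset.card_image_le (s := Finset.range (R + 1)) (f := fun m : ℕ => (p : ℤ) * m + s)
    rw [Finset.card_range] at this
    omega
  have h2 : (F \ ((1 : ℤ) +ᵥ F)).card = (((1 : ℤ) +ᵥ F) \ F).card :=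
    Finset.card_sdiff_comm (Finset.card_vadd_finset _ _).symm
  have h3 : (((1 : ℤ) +ᵥ F) ∆ F).card ≤ (((1 : ℤ) +ᵥ F) \ F).card + (F \ ((1 : ℤ) +ᵥ F)).card :=
    Finset.card_union_le _ _
  omega

theorem isFolnerSeq_of_tendsto_one {F : ℕ → Finset ℤ} (hne : ∀ n, (F n).Nonempty)
    (h : Tendsto (fun n => ((((1 : ℤ) +ᵥ F n) ∆ F n).card : ℝ) / ((F n).card : ℝ)) atTop (𝓝 0)) :
    IsFolnerSeq F := by
  refine ⟨hne, ?_⟩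
  have hneg : ∀ g : ℤ, ∀ n, (((-g) +ᵥ F n) ∆ F n).card = ((g +ᵥ F n) ∆ F n).card := by
    intro g n
    rw [← Finset.card_vadd_finset g (((-g) +ᵥ F n) ∆ F n), Finset.vadd_finset_symmDiff,
      vadd_vadd, add_neg_cancel, zero_vadd, symmDiff_comm]
  have hnat : ∀ k : ℕ, Tendsto (fun n => ((((k : ℤ) +ᵥ F n) ∆ F n).card : ℝ) /
      ((F n).card : ℝ)) atTop (𝓝 0) := by
    intro k
    induction k with
    | zero => simp
    | succ k ih =>
      refine squeeze_zero (fun n => by positivity) (fun n => ?_) (by simpa using ih.add h)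
      rw [← add_div]
      gcongr
      have h1 : ((((k + 1 : ℕ) : ℤ) +ᵥ F n) ∆ F n) ⊆
          (((k + 1 : ℕ) : ℤ) +ᵥ F n) ∆ ((k : ℤ) +ᵥ F n) ∪ ((k : ℤ) +ᵥ F n) ∆ F n :=
        symmDiff_triangle _ _ _
      have h2 : (((k + 1 : ℕ) : ℤ) +ᵥ F n) ∆ ((k : ℤ) +ᵥ F n) =
          (k : ℤ) +ᵥ (((1 : ℤ) +ᵥ F n) ∆ F n) := by
        rw [Finset.vadd_finset_symmDiff, vadd_vadd]
        push_cast
        rfl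
      have h3 := (Finset.card_le_card h1).trans (Finset.card_union_le _ _)
      rw [h2, Finset.card_vadd_finset] at h3
      rw [add_comm (Finset.card _)] at h3
      exact_mod_cast h3
  intro g
  obtain ⟨k, rfl | rfl⟩ := Int.eq_nat_or_neg g
  · exact hnat k
  · simpa only [hneg] using hnat k

theorem isFolnerSeq_puncturedBlocks {p R s L : ℕ → ℕ} (hp : Tendsto p atTop atTop)
    (hR : ∀ n, 0 < R n) (hs : ∀ n, s n + L n ≤ p n) (hL : ∀ n, 2 * L n ≤ p n)
    (hp0 : ∀ n, 0 < p n) :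
    IsFolnerSeq fun n => puncturedBlocks (p n) (R n) (s n) (L n) := by
  have hcard : ∀ n, (p n * R n : ℝ) ≤ 2 * ((puncturedBlocks (p n) (R n) (s n) (L n)).card : ℝ) := by
    intro n
    rw [card_puncturedBlocks (hs n)]
    have : p n * R n ≤ 2 * (R n * (p n - L n)) := by
      have : p n ≤ 2 * (p n - L n) := by have := hL n; omega
      nlinarith [hR n]
    exact_mod_cast this
  refine isFolnerSeq_of_tendsto_one (fun n => ?_) ?_
  · rw [← Finset.card_pos, card_puncturedBlocks (hs n)]
    have := hL n
    have := hp0 n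
    exact Nat.mul_pos (hR n) (by omega)
  · have hp' : Tendsto (fun n => (12 : ℝ) / p n) atTop (𝓝 0) :=
      (tendsto_natCast_atTop_atTop.comp hp).const_div_atTop 12
    refine squeeze_zero (fun n => by positivity) (fun n => ?_) hp'
    have h1 : (0 : ℝ) < p n := by exact_mod_cast hp0 n
    have h2 : (1 : ℝ) ≤ R n := by exact_mod_cast hR n
    have h3 := hcard n
    have h4 : (0 : ℝ) < (puncturedBlocks (p n) (R n) (s n) (L n)).card := by
      have := mul_pos h1 (zero_lt_one.trans_le h2)
      linarith
    have h5 : (((((1 : ℤ) +ᵥ puncturedBlocks (p n) (R n) (s n) (L n)) ∆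
        puncturedBlocks (p n) (R n) (s n) (L n)).card : ℕ) : ℝ) ≤ 2 * R n + 4 := by
      exact_mod_cast card_one_vadd_symmDiff_puncturedBlocks_le
    rw [div_le_div_iff₀ h4 h1]
    calc _ ≤ (2 * R n + 4) * (p n : ℝ) := by gcongr
      _ ≤ 6 * (p n * R n) := by nlinarith
      _ ≤ _ := by linarith

theorem isTempered_of_subset_Ico {F : ℕ → Finset ℤ} {w v : ℕ → ℕ} {c : ℝ}
    (hc : 0 ≤ c)
    (hF : ∀ n, ∀ x ∈ F n, 0 ≤ x ∧ x < (w n : ℤ)) (hv : ∀ n, ∀ i < n, w i ≤ v n)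
    (h : ∀ n, 0 < n → (w n + v n : ℝ) ≤ c * (F n).card) : IsTempered c F := by
  intro n
  rcases Nat.eq_zero_or_pos n with rfl | hn
  · simp only [Finset.range_zero, Finset.biUnion_empty, Finset.card_empty, Nat.cast_zero]
    positivity
  refine le_trans ?_ (h n hn)
  have hsub : ((Finset.range n).biUnion fun i => -F i + F n) ⊆
      Finset.Ico (-(v n : ℤ)) (w n : ℤ) := by
    intro x hx
    obtain ⟨i, hi, hx⟩ := Finset.mem_biUnion.1 hx
    obtain ⟨a, ha, b, hb, rfl⟩ := Finset.mem_add.1 hx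
    have ha := hF i _ (Finset.mem_neg'.1 ha)
    have hb := hF n b hb
    have := hv n i (Finset.mem_range.1 hi)
    rw [Finset.mem_Ico]
    omega
  have := Finset.card_le_card hsub
  rw [Int.card_Ico] at this
  have : ((Finset.range n).biUnion fun i => -F i + F n).card ≤ w n + v n := by omega
  exact_mod_cast this

end PuncturedBlocks

/-! ### Averages along the blocks, and the set carrying all patterns -/

section Fluctuations

theorem Fluctuates.mono {a : ℕ → ℝ} {α β : ℝ} {M N : ℕ} (h : Fluctuates a α β M) (hNM : N ≤ M) :
    Fluctuates a α β N := by
  obtain ⟨n, hn, h⟩ := h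
  exact ⟨fun i => n (Fin.castLE (by omega) i), fun i j hij => hn (by simpa using hij),
    fun i => h (Fin.castLE (by omega) i)⟩

theorem fluctuates_of_parity {a : ℕ → ℝ} {α β : ℝ} {k M : ℕ}
    (heven : ∀ i < 2 * M, Even i → a (2 * k + i) ≤ α)
    (hodd : ∀ i < 2 * M, Odd i → β ≤ a (2 * k + i)) : Fluctuates a α β M :=
  ⟨fun i => 2 * k + i, fun i j hij => by simpa using hij,
    fun i => ⟨heven i i.2, hodd i i.2⟩⟩

theorem exists_index_of_strictMono {b : ℕ → ℕ} (hb : StrictMono b) :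
    ∃ κ : ℕ → ℕ, Monotone κ ∧ Tendsto κ atTop atTop ∧
      ∀ k n, b k ≤ n → n < b (k + 1) → κ n = k := by
  have hmono : Monotone fun n => Nat.findGreatest (fun k => b k ≤ n) n :=
    fun m n hmn => Nat.findGreatest_mono (fun k (hk : b k ≤ m) => hk.trans hmn) hmn
  refine ⟨fun n => Nat.findGreatest (fun k => b k ≤ n) n, hmono,
    tendsto_atTop_atTop_of_monotone hmono fun k => ⟨b k, ?_⟩, fun k n h1 h2 => ?_⟩
  · exact Nat.le_findGreatest (hb.le_apply) le_rfl
  · refine (Nat.findGreatest_eq_iff).2 ⟨hb.le_apply.trans h1, fun _ => h1, fun j hj _ hcon => ?_⟩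
    have : b (k + 1) ≤ b j := hb.monotone hj
    omega

variable {X : Type*} [AddAction ℤ X]

theorem mem_fluctuationSet {F : ℕ → Finset ℤ} {f : X → ℝ} {α β : ℝ} {N : ℕ} {x : X} :
    x ∈ fluctuationSet F f α β N ↔ Fluctuates (fun n => ergodicAverage (F n) f x) α β N := by
  rw [fluctuationSet, Set.mem_ofPred_eq]

theorem ergodicAverage_puncturedBlocks {Ω : Set X} {p R s L W h : ℕ} {x : X} (hR : 0 < R)
    (hpR : p * R ≤ W) (hs : s + L ≤ p)
    (hx : ∀ g : ℕ, g < W → ((g : ℤ) +ᵥ x ∈ Ω ↔ g % p < h)) :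
    ergodicAverage (puncturedBlocks p R s L) (Ω.indicator 1) x =
      (((Finset.range p \ Finset.Ico s (s + L)).filter (· < h)).card : ℝ) / ((p : ℝ) - L) := by
  have hR' : (R : ℝ) ≠ 0 := by exact_mod_cast hR.ne'
  rw [ergodicAverage, card_puncturedBlocks hs,
    sum_puncturedBlocks _ (fun y => if y < h then (1 : ℝ) else 0), Finset.sum_boole,
    Nat.cast_mul, Nat.cast_sub (by omega), mul_div_mul_left _ _ hR']
  intro m y hm hy
  have hlt : p * m + y < W := by
    calc p * m + y < p * (m + 1) := by rw [mul_add]; omega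
      _ ≤ p * R := Nat.mul_le_mul_left _ hm
      _ ≤ W := hpR
  have := hx (p * m + y) hlt
  rw [Nat.mul_add_mod, Nat.mod_eq_of_lt hy] at this
  push_cast at this
  classical
  simp only [Set.indicator_apply, this, Pi.one_apply]

/-- Every block contributes equally, so the number `R` of blocks cancels and is free to be used for
temperedness. -/
theorem ergodicAverage_puncturedBlocks_le {Ω : Set X} {p R L W Q : ℕ} {x : X} (hQ : 2 ≤ Q)
    (hL : 0 < L) (hR : 0 < R) (hpR : p * R ≤ W) (hp : 2 * Q * L ≤ p)
    (hx : ∀ g : ℕ, g < W → ((g : ℤ) +ᵥ x ∈ Ω ↔ g % p < Q * L)) :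
    ergodicAverage (puncturedBlocks p R 0 L) (Ω.indicator 1) x ≤
      ((Q : ℝ) - 1) / (2 * Q - 1) := by
  have hQL : 2 * L ≤ Q * L := Nat.mul_le_mul_right _ hQ
  have hp' : 2 * (Q * L) ≤ p := by rw [← mul_assoc]; exact hp
  rw [ergodicAverage_puncturedBlocks hR hpR (by omega) hx]
  have hset : (Finset.range p \ Finset.Ico 0 (0 + L)).filter (· < Q * L) =
      Finset.Ico L (Q * L) := by
    ext y
    simp only [Finset.mem_filter, Finset.mem_sdiff, Finset.mem_range, Finset.mem_Ico]
    omega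
  rw [hset, Nat.card_Ico, Nat.cast_sub (by omega), Nat.cast_mul]
  have h1 : (2 : ℝ) ≤ Q := by exact_mod_cast hQ
  have h2 : (0 : ℝ) < L := by exact_mod_cast hL
  have h3 : 2 * (Q * L : ℝ) ≤ p := by exact_mod_cast hp'
  have h4 : 2 * (L : ℝ) ≤ Q * L := by exact_mod_cast hQL
  rw [div_le_div_iff₀ (by linarith) (by linarith)]
  nlinarith

theorem le_ergodicAverage_puncturedBlocks {Ω : Set X} {p R L W Q : ℕ} {x : X} (hQ : 2 ≤ Q)
    (hL : 0 < L) (hR : 0 < R) (hpR : p * R ≤ W) (hp : 2 * Q * L ≤ p)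
    (hp2 : p ≤ 2 * Q * L + L)
    (hx : ∀ g : ℕ, g < W → ((g : ℤ) +ᵥ x ∈ Ω ↔ g % p < Q * L)) :
    1 / 2 ≤ ergodicAverage (puncturedBlocks p R (Q * L) L) (Ω.indicator 1) x := by
  have hQL : 2 * L ≤ Q * L := Nat.mul_le_mul_right _ hQ
  rw [mul_assoc] at hp hp2
  rw [ergodicAverage_puncturedBlocks hR hpR (by omega) hx]
  have hset : (Finset.range p \ Finset.Ico (Q * L) (Q * L + L)).filter (· < Q * L) =
      Finset.range (Q * L) := by
    ext y
    simp only [Finset.mem_filter, Finset.mem_sdiff, Finset.mem_range, Finset.mem_Ico]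
    omega
  rw [hset, Finset.card_range, Nat.cast_mul]
  have h2 : (0 : ℝ) < L := by exact_mod_cast hL
  have h3 : 2 * (Q * L : ℝ) ≤ p := by exact_mod_cast hp
  have h4 : 2 * (L : ℝ) ≤ Q * L := by exact_mod_cast hQL
  have h5 : (p : ℝ) ≤ 2 * (Q * L) + L := by exact_mod_cast hp2
  rw [div_le_div_iff₀ (by norm_num) (by linarith)]
  linarith

/-- Each region is chosen small relative to the preceding `ε`, so that later stages cannot spoil
earlier ones. No window length is fixed yet. -/
theorem exists_seq_hasPeriodicWindows [MeasurableSpace X] [MeasurableConstVAdd ℤ X]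
    {μ : Measure X} [VAddInvariantMeasure ℤ X μ] [IsProbabilityMeasure μ] (hX : NoTrivialPower X μ)
    (P : ℕ) :
    ∃ (p : ℕ → ℕ) (ε : ℕ → ℝ), StrictMono p ∧ (∀ k, P ≤ p k) ∧ (∀ k, 0 < ε k) ∧
      (∀ k, ε (k + 1) ≤ ε k / 4) ∧ ∀ k, HasPeriodicWindows μ (p k) (ε (k + 1)) (ε k / 4) := by
  have step : ∀ s : ℕ × {ε : ℝ // 0 < ε}, ∃ t : ℕ × {ε : ℝ // 0 < ε},
      s.1 < t.1 ∧ t.2.1 ≤ s.2.1 / 4 ∧ HasPeriodicWindows μ t.1 t.2.1 (s.2.1 / 4) := by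
    rintro ⟨q, ε, hε⟩
    obtain ⟨p, hp, η, hη, hw⟩ := exists_hasPeriodicWindows (μ := μ) hX (q + 1)
      (show 0 < ε / 4 by positivity)
    refine ⟨⟨p, min η (ε / 4), lt_min hη (by positivity)⟩, hp, min_le_right _ _, fun W h hh => ?_⟩
    obtain ⟨S, Z, E, h1, h2, h3, h4, h5, h6⟩ := hw W h hh
    exact ⟨S, Z, E, h1, h2, h3, h4, (min_le_left _ _).trans h5, h6⟩
  choose next h1 h2 h3 using step
  let s : ℕ → ℕ × {ε : ℝ // 0 < ε} := fun n => Nat.rec (P, ⟨1, one_pos⟩) (fun _ => next) n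
  have hs : ∀ n, s (n + 1) = next (s n) := fun _ => rfl
  have hmono : StrictMono fun k => (s k).1 := strictMono_nat_of_lt_succ fun k => by
    rw [hs]; exact h1 (s k)
  refine ⟨fun k => (s (k + 1)).1, fun k => (s k).2.1,
    fun k l hkl => hmono (Nat.succ_lt_succ hkl), fun k => hmono.monotone (Nat.zero_le (k + 1)),
    fun k => (s k).2.2, fun k => ?_, fun k => ?_⟩
  · simp only [hs]; exact h2 (s k)
  · simp only [hs]; exact h3 (s k)

/-- Inside `S k` the traces of earlier stages are erased. A point of `E k` sees the pattern of stage
`k` unless it reaches a later region within that region's own window; as `W` is monotone this also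
covers the window of stage `k`. The geometric decay of `ε` bounds the exceptional set by half of `ε
(k + 1)`. -/
theorem exists_set_of_hasPeriodicWindows [MeasurableSpace X] {μ : Measure X} [IsFiniteMeasure μ] {p W h : ℕ → ℕ} {ε : ℕ → ℝ}
    (hε : ∀ k, 0 < ε k) (hε4 : ∀ k, ε (k + 1) ≤ ε k / 4)
    (hw : ∀ k, HasPeriodicWindows μ (p k) (ε (k + 1)) (ε k / 4))
    (hW : Monotone W) (hh : ∀ k, h k ≤ p k) :
    ∃ Ω : Set X, MeasurableSet Ω ∧ ∀ k, ∃ G : Set X, ε (k + 1) / 2 ≤ μ.real G ∧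
      ∀ x ∈ G, ∀ g : ℕ, g < W k → ((g : ℤ) +ᵥ x ∈ Ω ↔ g % p k < h k) := by
  choose S Z E hS hZ hZS hE hμE hμS using fun k => hw k (W k) (h k) (hh k)
  refine ⟨⋃ k, Z k \ ⋃ i, S (k + 1 + i), MeasurableSet.iUnion fun k =>
    (hZ k).diff (MeasurableSet.iUnion fun i => hS _), fun k => ?_⟩
  set bad : Set X := ⋃ i, ⋃ g ∈ Finset.range (W (k + 1 + i)), shiftPreimage (g : ℤ) (S (k + 1 + i))
    with hbad
  refine ⟨E k \ bad, ?_, ?_⟩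
  · have hdecay : ∀ i, ε (k + 1 + i) ≤ ε (k + 1) * (1 / 2) ^ i := by
      intro i
      induction i with
      | zero => simp
      | succ i ih =>
        have h1 := hε4 (k + 1 + i)
        have h2 := hε (k + 1 + i)
        rw [pow_succ, ← add_assoc]
        linarith
    have hsum : HasSum (fun i : ℕ => ε (k + 1) / 4 * (1 / 2) ^ i) (ε (k + 1) / 4 * 2) :=
      hasSum_geometric_two.mul_left _
    have hμbad : μ bad ≤ ENNReal.ofReal (ε (k + 1) / 2) := by
      calc μ bad ≤ ∑' i, μ (⋃ g ∈ Finset.range (W (k + 1 + i)),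
              shiftPreimage (g : ℤ) (S (k + 1 + i))) := measure_iUnion_le _
        _ ≤ ∑' i, ENNReal.ofReal (ε (k + 1) / 4 * (1 / 2) ^ i) := by
            refine ENNReal.tsum_le_tsum fun i => ?_
            rw [← ofReal_measureReal (measure_ne_top _ _)]
            refine ENNReal.ofReal_le_ofReal ((hμS (k + 1 + i)).trans ?_)
            have := hdecay i
            linarith
        _ = ENNReal.ofReal (ε (k + 1) / 2) := by
            rw [← ENNReal.ofReal_tsum_of_nonneg _ hsum.summable, hsum.tsum_eq]
            · congr 1; ring
            · intro i; have := hε (k + 1); positivity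
    have h1 : μ.real bad ≤ ε (k + 1) / 2 :=
      ENNReal.toReal_le_of_le_ofReal (by have := hε (k + 1); positivity) hμbad
    have h2 : μ.real (E k) ≤ μ.real (E k \ bad ∪ bad) := measureReal_mono (by simp)
    have h3 := measureReal_union_le (μ := μ) (E k \ bad) bad
    have h4 := hμE k
    linarith
  · rintro x ⟨hxE, hxbad⟩ g hg
    obtain ⟨hgS, hgZ⟩ := hE k x hxE g hg
    have hlater : ∀ j, k < j → (g : ℤ) +ᵥ x ∉ S j := by
      intro j hkj hcon
      obtain ⟨i, rfl⟩ := Nat.exists_eq_add_of_le hkj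
      refine hxbad (Set.mem_iUnion.2 ⟨i, Set.mem_biUnion (x := g) ?_ hcon⟩)
      exact Finset.mem_coe.2 (Finset.mem_range.2 (hg.trans_le (hW (by omega))))
    rw [← hgZ]
    constructor
    · intro hΩ
      obtain ⟨j, hjZ, hjS⟩ := Set.mem_iUnion.1 hΩ
      rcases lt_trichotomy j k with hjk | rfl | hkj
      · obtain ⟨i, rfl⟩ := Nat.exists_eq_add_of_le hjk
        exact absurd (Set.mem_iUnion.2 ⟨i, hgS⟩) hjS
      · exact hjZ
      · exact absurd (hZS j hjZ) (hlater j hkj)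
    · intro hz
      refine Set.mem_iUnion.2 ⟨k, hz, fun hcon => ?_⟩
      obtain ⟨i, hi⟩ := Set.mem_iUnion.1 hcon
      exact hlater _ (by omega) hi

end Fluctuations

/-! ### Choice of parameters and assembly -/

theorem exists_seq_forall_lt {ω ε : ℕ → ℝ} (hω : Tendsto ω atTop (𝓝 0)) (hε : ∀ k, 0 < ε k) :
    ∃ M : ℕ → ℕ, (∀ k, k < M k) ∧ ∀ k, ∀ N ≥ M k, ω N < ε k := by
  have h : ∀ k, ∃ m : ℕ, ∀ N ≥ m, ω N < ε k := fun k =>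
    eventually_atTop.1 (hω.eventually_lt_const (hε k))
  choose m hm using h
  refine ⟨fun k => m k + k + 1, fun k => by dsimp only; omega, fun k N hN => hm k N ?_⟩
  dsimp only at hN
  omega

theorem theorem1p4 {X : Type*} [MeasurableSpace X] [AddAction ℤ X] [MeasurableConstVAdd ℤ X]
    (μ : Measure X) [IsProbabilityMeasure μ] [VAddInvariantMeasure ℤ X μ]
    (hX : NoTrivialPower X μ)
    (ω : ℕ → ℝ) (hω_anti : Antitone ω) (hω_lim : Tendsto ω atTop (𝓝 0))
    (l : ℝ) (hl : 0 < l) :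
    ∃ (α β : ℝ) (f : X → ℝ) (F : ℕ → Finset ℤ),
      α < β ∧ Measurable f ∧ (∀ x, 0 ≤ f x ∧ f x ≤ 1) ∧
      IsFolnerSeq F ∧ IsTempered (1 + l) F ∧
      ∀ᶠ N in atTop, ω N < μ.real (fluctuationSet F f α β N) := by
  -- The second condition is `Q + 1 ≤ (1 + l) * (Q - 1 / 2)`, exactly what temperedness needs.
  obtain ⟨Q, hQ, hlQ⟩ : ∃ Q : ℕ, 2 ≤ Q ∧ 3 / 2 + l / 2 ≤ l * Q := by
    obtain ⟨n, hn⟩ := exists_nat_ge ((3 / 2 + l / 2) / l)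
    refine ⟨n + 2, by omega, ?_⟩
    rw [div_le_iff₀ hl] at hn
    push_cast
    nlinarith
  have hQr : (2 : ℝ) ≤ Q := by exact_mod_cast hQ
  obtain ⟨p, ε, hp, hPp, hε, hε4, hw⟩ :=
    exists_seq_hasPeriodicWindows (μ := μ) hX (2 * Q * (2 * Q))
  -- The index is `k + 2` because the values `M k < N ≤ M (k + 1)` are served by stage `k + 1`,
  -- whose good set has measure at least `ε (k + 2) / 2`.
  obtain ⟨M, hkM, hM⟩ := exists_seq_forall_lt hω_lim (ε := fun k => ε (k + 2) / 2)
    fun k => half_pos (hε _)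
  obtain ⟨a, ha⟩ : ∃ a : ℕ → ℕ, ∀ k, a (k + 1) = a k + M k :=
    ⟨fun k => ∑ j ∈ Finset.range k, M j, fun k => Finset.sum_range_succ _ _⟩
  have hb : StrictMono fun k => 2 * a k := strictMono_nat_of_lt_succ fun k => by
    have := ha k
    have := hkM k
    omega
  obtain ⟨κ, hκ_mono, hκ_lim, hκ⟩ := exists_index_of_strictMono hb
  obtain ⟨L, hLdef⟩ : ∃ L : ℕ → ℕ, ∀ k, L k = p k / (2 * Q) := ⟨_, fun _ => rfl⟩
  have hL1 : ∀ k, 2 * Q ≤ L k := fun k => by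
    rw [hLdef]; exact (Nat.le_div_iff_mul_le (by omega)).2 (hPp k)
  have hL2 : ∀ k, 2 * Q * L k ≤ p k := fun k => by
    rw [hLdef]; exact Nat.mul_div_le _ _
  -- The remainder of `p k` modulo `2 * Q` is absorbed by `L k`; hence the starting bound `2 * Q *
  -- (2 * Q)` on the periods.
  have hL3 : ∀ k, p k ≤ 2 * Q * L k + L k := fun k => by
    have h1 := Nat.div_add_mod (p k) (2 * Q)
    have h2 := Nat.mod_lt (p k) (show 0 < 2 * Q by omega)
    have h3 := hL1 k
    rw [← hLdef] at h1
    omega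
  have hQL : ∀ k, 2 * L k ≤ Q * L k := fun k => Nat.mul_le_mul_right _ hQ
  have hQLp : ∀ k, 2 * (Q * L k) ≤ p k := fun k => by rw [← mul_assoc]; exact hL2 k
  obtain ⟨Ω, hΩ, hG⟩ := exists_set_of_hasPeriodicWindows (μ := μ)
    (W := fun k => p k * Q ^ (2 * a (k + 1))) (h := fun k => Q * L k) hε hε4 hw
    (fun i j hij => Nat.mul_le_mul (hp.monotone hij)
      (Nat.pow_le_pow_right (by omega) (hb.monotone (Nat.succ_le_succ hij))))
    (fun k => by have := hQLp k; omega)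
  -- Even indices delete from the pattern, odd ones from its complement. Stage `k` occupies the
  -- indices from `2 * a k` to `2 * a (k + 1) - 1`, so it starts at an even index.
  let s : ℕ → ℕ := fun n => if Even n then 0 else Q * L (κ n)
  have hs : ∀ n, s n + L (κ n) ≤ p (κ n) := fun n => by
    have h1 := hQLp (κ n)
    have h2 := hQL (κ n)
    simp only [s]
    split_ifs <;> omega
  have hQpow : ∀ n, 0 < Q ^ n := fun n => Nat.pow_pos (by omega)
  let F : ℕ → Finset ℤ := fun n => puncturedBlocks (p (κ n)) (Q ^ n) (s n) (L (κ n))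
  refine ⟨((Q : ℝ) - 1) / (2 * Q - 1), 1 / 2, Ω.indicator 1, F, ?_,
    measurable_one.indicator hΩ, fun x => ⟨Set.indicator_nonneg (fun _ _ => zero_le_one) x,
      Set.indicator_le_self' (fun _ _ => zero_le_one) x⟩, ?_, ?_, ?_⟩
  · rw [div_lt_div_iff₀ (by linarith) (by norm_num)]
    linarith
  · refine isFolnerSeq_puncturedBlocks (hp.tendsto_atTop.comp hκ_lim) hQpow hs (fun n => ?_)
      fun n => ?_
    · have h1 := hQLp (κ n)
      have h2 := hQL (κ n)
      omega
    · have h1 := hL1 (κ n)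
      have h2 := hs n
      omega
  · refine isTempered_of_subset_Ico (w := fun n => p (κ n) * Q ^ n)
      (v := fun n => p (κ n) * Q ^ (n - 1)) (by linarith)
      (fun n x hx => nonneg_and_lt_of_mem_puncturedBlocks hx) (fun n i hi => ?_) (fun n hn => ?_)
    · exact Nat.mul_le_mul (hp.monotone (hκ_mono hi.le))
        (Nat.pow_le_pow_right (by omega) (by omega))
    · obtain ⟨m, rfl⟩ : ∃ m, n = m + 1 := ⟨n - 1, by omega⟩
      have h1 : (2 * (Q * L (κ (m + 1))) : ℝ) ≤ p (κ (m + 1)) := by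
        exact_mod_cast hQLp (κ (m + 1))
      have h2 : (0 : ℝ) ≤ (Q : ℝ) ^ m := by positivity
      have h3 : L (κ (m + 1)) ≤ p (κ (m + 1)) := by have := hs (m + 1); omega
      have hp0 : (0 : ℝ) ≤ p (κ (m + 1)) := Nat.cast_nonneg _
      simp only [F]
      rw [card_puncturedBlocks (hs _), Nat.add_sub_cancel]
      push_cast [h3]
      have h4 : (p (κ (m + 1)) : ℝ) * (Q + 1) ≤
          (1 + l) * (Q * (p (κ (m + 1)) - L (κ (m + 1)))) := by
        calc (p (κ (m + 1)) : ℝ) * (Q + 1)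
            ≤ p (κ (m + 1)) * ((1 + l) * (Q - 1 / 2)) := by
              refine mul_le_mul_of_nonneg_left ?_ hp0
              linarith
          _ = (1 + l) * (Q * p (κ (m + 1)) - p (κ (m + 1)) / 2) := by ring
          _ ≤ _ := by
              refine mul_le_mul_of_nonneg_left ?_ (by linarith)
              linarith
      calc _ = (p (κ (m + 1)) : ℝ) * (Q + 1) * Q ^ m := by ring
        _ ≤ (1 + l) * (Q * (p (κ (m + 1)) - L (κ (m + 1)))) * Q ^ m :=
            mul_le_mul_of_nonneg_right h4 h2
        _ = _ := by ring
  · have hstage : ∀ k, ε (k + 1) / 2 ≤ μ.real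
        (fluctuationSet F (Ω.indicator 1) (((Q : ℝ) - 1) / (2 * Q - 1)) (1 / 2) (M k)) := by
      intro k
      obtain ⟨G, hμG, hG⟩ := hG k
      refine hμG.trans (measureReal_mono (fun x hx => ?_) (measure_ne_top _ _))
      have hκk : ∀ i < 2 * M k, κ (2 * a k + i) = k := fun i hi =>
        hκ k _ (by omega) (by have := ha k; omega)
      have hwin : ∀ i < 2 * M k, p k * Q ^ (2 * a k + i) ≤ p k * Q ^ (2 * a (k + 1)) :=
        fun i hi => Nat.mul_le_mul_left _
          (Nat.pow_le_pow_right (by omega) (by have := ha k; omega))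
      have hL0 : 0 < L k := by have := hL1 k; omega
      rw [mem_fluctuationSet]
      refine fluctuates_of_parity (k := a k) (fun i hi heven => ?_) fun i hi hodd => ?_
      · have hpar : Even (2 * a k + i) := (even_two_mul _).add heven
        simp only [F, s, if_pos hpar, hκk i hi]
        exact ergodicAverage_puncturedBlocks_le hQ hL0 (hQpow _) (hwin i hi) (hL2 k) (hG x hx)
      · have hpar : ¬ Even (2 * a k + i) :=
          Nat.not_even_iff_odd.2 ((even_two_mul _).add_odd hodd)
        simp only [F, s, if_neg hpar, hκk i hi]
        exact le_ergodicAverage_puncturedBlocks hQ hL0 (hQpow _) (hwin i hi) (hL2 k) (hL3 k)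
          (hG x hx)
    filter_upwards [eventually_gt_atTop (M 0)] with N hN
    -- The least such `k` is positive since `M 0 < N`; it is the stage that yields enough
    -- fluctuations, while its predecessor controls `ω N`.
    have hex : ∃ k, N ≤ M k := ⟨N, (hkM N).le⟩
    obtain ⟨k, hk⟩ : ∃ k, Nat.find hex = k + 1 := by
      refine Nat.exists_eq_succ_of_ne_zero fun h0 => ?_
      have := Nat.find_spec hex
      rw [h0] at this
      omega
    have h1 : N ≤ M (k + 1) := hk ▸ Nat.find_spec hex
    have h2 : M k < N := not_le.1 (Nat.find_min hex (by omega))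
    calc ω N < ε (k + 2) / 2 := hM k N h2.le
      _ ≤ _ := hstage (k + 1)
      _ ≤ μ.real (fluctuationSet F (Ω.indicator 1) (((Q : ℝ) - 1) / (2 * Q - 1)) (1 / 2) N) :=
          measureReal_mono (fun x hx => mem_fluctuationSet.2
            ((mem_fluctuationSet.1 hx).mono h1)) (measure_ne_top _ _)
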